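/- Let $k\ge 2$, write points of $\mathbb{R}^k=\mathbb{R}^2\times\mathbb{R}^{k-2}$ as $(x,z)$, and write $\nu=(\nu_x,\nu_z)$ for vectors $\nu\in\mathbb{R}^k$ accordingly. Let $e_1=(1,0)$ and, for $\gamma\in\mathbb{R}$, let $R_\gamma$ be the counterclockwise rotation of $\mathbb{R}^2$ by the angle $\gamma$. A Lebesgue measurable set $E\subset\mathbb{R}^k$ has locally finite perimeter if for every open set $U$ with compact closure $\sup\{\int_E \operatorname{div}T : T\in C^1_c(U;\mathbb{R}^k),\ |T|\le 1\}<\infty$; then the distributional derivative $D\chi_E$ of its characteristic function is an $\mathbb{R}^k$-valued Radon measure, with total variation $|D\chi_E|$. The reduced boundary $\partial^*E$ is the set of points $p\in\mathbb{R}^k$ at which the limit $\nu^E(p):=\lim_{\rho\to0^+}D\chi_E(B_\rho(p))/|D\chi_E|(B_\rho(p))$ exists and is a unit vector, and $\nu^E(p)$ is then the measure-theoretic inner unit normal to $E$ at $p$. Let $\mu:(0,\infty)\times\mathbb{R}^{k-2}\to[0,\infty)$ be Lebesgue measurable with $\mu(r,z)\le 2\pi r$ for almost every $(r,z)$, and suppose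 that the set $$F_\mu=\Big\{(x,z)\in(\mathbb{R}^2\setminus\{0\})\times\mathbb{R}^{k-2} : 2|x|\arccos\Big(\frac{x}{|x|}\cdot e_1\Big)<\mu(|x|,z)\Big\}$$ has locally finite perimeter. **Proposition.** Let $(x,z)\in\partial^*F_\mu$ with $x=r(\cos\beta,\sin\beta)$, where $r>0$ and $\beta\in(-\pi,\pi]$. Then, for every $\gamma\in[\min\{-\beta,0\},\max\{-\beta,0\}]$ such that $(R_\gamma x,z)\in\partial^*F_\mu$, $$\nu^{F_\mu}(R_\gamma x,z)=\big(R_\gamma\,\nu^{F_\mu}_x(x,z),\ \nu^{F_\mu}_z(x,z)\big).$$ -/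

import Mathlib

open MeasureTheory Set Filter Topology

noncomputable section

section FinitePerimeter

variable {V : Type*} [NormedAddCommGroup V] [InnerProductSpace ℝ V] [FiniteDimensional ℝ V]
  [MeasurableSpace V] [BorelSpace V]

/-- The divergence of a vector field, i.e. the trace of its derivative. -/
def divergence (T : V → V) (p : V) : ℝ :=
  LinearMap.trace ℝ V (fderiv ℝ T p : V →ₗ[ℝ] V)

/-- `E` is a set of locally finite perimeter: it is Lebesgue measurable, and for every open set `U`
with compact closure the integrals over `E` of `div T`, where `T` ranges over the `C¹` fields with
compact support in `U` and `|T| ≤ 1`, are bounded above. -/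
def HasLocallyFinitePerimeter (E : Set V) : Prop :=
  NullMeasurableSet E (volume : Measure V) ∧
    ∀ U : Set V, IsOpen U → IsCompact (closure U) →
      ∃ C : ℝ, ∀ T : V → V, ContDiff ℝ 1 T → HasCompactSupport T → tsupport T ⊆ U →
        (∀ p, ‖T p‖ ≤ 1) → ∫ p in E, divergence T p ≤ C

/-- The vector-valued Radon measure with polar decomposition `σ m` (`m` a Radon measure, `σ` a
Borel field with `|σ| = 1` at `m`-almost every point) is the distributional derivative of the
characteristic function of `E`. For a given `E` there is at most one such measure `σ m`, and `m` is
its total variation; for a set of locally finite perimeter it exists by Riesz' theorem. -/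
structure IsDerivOfIndicator (E : Set V) (m : Measure V) (σ : V → V) : Prop where
  locallyFinite : IsLocallyFiniteMeasure m
  measurable : Measurable σ
  norm_eq_one : ∀ᵐ p ∂m, ‖σ p‖ = 1
  integral_div : ∀ T : V → V, ContDiff ℝ 1 T → HasCompactSupport T →
    ∫ p in E, divergence T p = -∫ p, inner ℝ (T p) (σ p) ∂m

open Classical in
/-- The polar decomposition `(|Dχ_E|, dDχ_E/d|Dχ_E|)` of the distributional derivative of the
characteristic function of `E` (and `(0, 0)` if that derivative is not a Radon measure). -/
def indicatorDeriv (E : Set V) : Measure V × (V → V) :=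
  if h : ∃ d : Measure V × (V → V), IsDerivOfIndicator E d.1 d.2 then h.choose else (0, 0)

/-- The total variation measure `|Dχ_E|`. -/
def perimeterMeasure (E : Set V) : Measure V := (indicatorDeriv E).1

/-- The value `Dχ_E(A)` of the vector-valued measure `Dχ_E` on a bounded Borel set `A`. -/
def gradMeasure (E : Set V) (A : Set V) : V :=
  ∫ p in A, (indicatorDeriv E).2 p ∂(perimeterMeasure E)

/-- The quotient `Dχ_E(B_ρ(p)) / |Dχ_E|(B_ρ(p))`. -/
def normalRatio (E : Set V) (p : V) (ρ : ℝ) : V :=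
  ((perimeterMeasure E (Metric.ball p ρ)).toReal)⁻¹ • gradMeasure E (Metric.ball p ρ)

/-- The reduced boundary `∂*E`: the points where the limit of `normalRatio` as `ρ → 0⁺` exists and
is a unit vector. -/
def reducedBoundary (E : Set V) : Set V :=
  {p | ∃ ν : V, ‖ν‖ = 1 ∧ Tendsto (normalRatio E p) (𝓝[>] 0) (𝓝 ν)}

/-- The measure-theoretic inner unit normal `ν^E` (meaningful at points of `∂*E`). -/
def innerNormal (E : Set V) (p : V) : V :=
  limUnder (𝓝[>] (0 : ℝ)) (normalRatio E p)

end FinitePerimeter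

/-- `ℝ^k = ℝ² × ℝ^(k-2)` with the Euclidean norm; here `k ≥ 2`. -/
abbrev Space (k : ℕ) : Type :=
  WithLp 2 (EuclideanSpace ℝ (Fin 2) × EuclideanSpace ℝ (Fin (k - 2)))

/-- The point `(x, z)` of `ℝ² × ℝ^(k-2)`. -/
def pt {k : ℕ} (x : EuclideanSpace ℝ (Fin 2)) (z : EuclideanSpace ℝ (Fin (k - 2))) : Space k :=
  WithLp.toLp 2 (x, z)

/-- The half-space `(0, ∞) × ℝ^(k-2)`. -/
def halfSpace (k : ℕ) : Set (ℝ × EuclideanSpace ℝ (Fin (k - 2))) := Ioi 0 ×ˢ univ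

/-- The counterclockwise rotation `R_γ` of the plane by the angle `γ`. -/
def rot (γ : ℝ) (x : EuclideanSpace ℝ (Fin 2)) : EuclideanSpace ℝ (Fin 2) :=
  !₂[Real.cos γ * x 0 - Real.sin γ * x 1, Real.sin γ * x 0 + Real.cos γ * x 1]

/-- The slice `E_(r,z)`, the set of `x ≠ 0` with `|x| = r` and `(x, z) ∈ E`. -/
def circularSlice {k : ℕ} (E : Set (Space k)) (r : ℝ) (z : EuclideanSpace ℝ (Fin (k - 2))) :
    Set (EuclideanSpace ℝ (Fin 2)) :=
  {x | x ≠ 0 ∧ ‖x‖ = r ∧ pt x z ∈ E}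

/-- The set `F_μ` of the points `(x, z)` with `x ≠ 0` and `2 |x| arccos(x̂ · e₁) < μ(|x|, z)`,
where `x̂ = x / |x|`. -/
def circularSymmetral {k : ℕ} (μ : ℝ × EuclideanSpace ℝ (Fin (k - 2)) → ℝ) : Set (Space k) :=
  {p | p.fst ≠ 0 ∧
    2 * ‖p.fst‖ * Real.arccos (inner ℝ (‖p.fst‖⁻¹ • p.fst) (EuclideanSpace.single 0 1))
      < μ (‖p.fst‖, p.snd)}

end

/-!
Write `F` for the circularly symmetric set and suppose `γ ≠ 0`. Near `(x, z)` the rotation by `γ`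
increases the first coordinate of the planar component, because `cos β < cos (β + γ)`. It therefore
decreases the angle to `e₁`, and as it preserves the radius it maps `F` into `F` near `(x, z)`
(`rotIsometry_mem_circularSymmetral`). Blowing up, the rotation maps the half-space bounded by the
tangent plane of `F` at `(x, z)` into the corresponding half-space at `(R_γ x, z)`. Two half-spaces
through the origin one of which contains the other are equal, so the normals correspond
(`normal_eq_of_image_subset`).

Of De Giorgi's blow-up theorem only this is needed: if `w · ν < 0` is sufficiently negative, then
`E` has density zero in the balls `B(p + ρ w, ρ)` as `ρ → 0`
(`IsGaussGreen.eventually_volume_inter_ball_le`), and symmetrically for the complement of `E`. It is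
obtained without any compactness theorem, from two estimates. Let `σ m` be the derivative of the
characteristic function.

* Translation (`IsGaussGreen.volume_translate_le`): the part of `E ∩ B_s` that leaves `E` under
  translation by `a` has volume at most the integral of `(a · σ)⁻` over `B_{s + |a|}`. Near a point
  of the reduced boundary `σ` is close to `ν` in the mean, so this is `o(ρⁿ)` when `a · ν ≥ 0` and
  `|a| = O(ρ)`.
* Lower density (`IsGaussGreen.exists_le_volume`): `|E ∩ B_ρ| ≥ c ρⁿ` at a point of the reduced
  boundary. Averaging the translation estimate over short vectors gives a local isoperimetric
  inequality (`IsGaussGreen.volume_le_perimeter`); together with a bound of the perimeter by the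
  volume, valid where the normal is nearly constant (`IsGaussGreen.perimeter_le_volume`), it feeds
  De Giorgi's iteration.

If `E` had positive density in `B(p + ρ w, ρ)`, then the points of `E` there could be moved by
vectors `a` with `a · ν ≥ 0` onto the points of `B_ρ(p)` outside `E`, which also have positive
density; by Fubini's theorem this contradicts the translation estimate.
-/

section Blowup

open Metric Module

set_option linter.unusedSectionVars false

variable {V : Type*} [NormedAddCommGroup V] [InnerProductSpace ℝ V] [FiniteDimensional ℝ V]
  [MeasurableSpace V] [BorelSpace V]

/-! ### Scalar form of the Gauss–Green formula -/

/-- `σ m` is the distributional gradient of the characteristic function of the Borel set `E`, the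
formula being tested on fields `φ v` with `φ` a scalar function and `v` a constant vector. -/
structure IsGaussGreen (E : Set V) (m : Measure V) (σ : V → V) : Prop where
  measurableSet : MeasurableSet E
  locallyFinite : IsLocallyFiniteMeasure m
  measurable : Measurable σ
  norm_eq_one : ∀ᵐ p ∂m, ‖σ p‖ = 1
  setIntegral_fderiv : ∀ φ : V → ℝ, ContDiff ℝ 1 φ → HasCompactSupport φ → ∀ v : V,
    ∫ p in E, fderiv ℝ φ p v = -∫ p, φ p * inner ℝ v (σ p) ∂m

lemma divergence_smul_const {φ : V → ℝ} {p : V} (hφ : DifferentiableAt ℝ φ p) (v : V) :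
    divergence (fun q => φ q • v) p = fderiv ℝ φ p v := by
  unfold divergence
  rw [fderiv_smul_const hφ]
  exact LinearMap.trace_smulRight (fderiv ℝ φ p : V →ₗ[ℝ] ℝ) v

/-- A set of locally finite perimeter may be replaced by a Borel set that differs from it by a null
set. -/
lemma IsDerivOfIndicator.isGaussGreen {E E₀ : Set V} {m : Measure V} {σ : V → V}
    (h : IsDerivOfIndicator E m σ) (hE₀ : MeasurableSet E₀) (hE : E₀ =ᵐ[volume] E) :
    IsGaussGreen E₀ m σ where
  measurableSet := hE₀
  locallyFinite := h.locallyFinite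
  measurable := h.measurable
  norm_eq_one := h.norm_eq_one
  setIntegral_fderiv φ hφ hc v := by
    have key := h.integral_div (fun q => φ q • v) (hφ.smul contDiff_const) hc.smul_right
    rw [setIntegral_congr_set hE]
    simp_rw [divergence_smul_const (hφ.differentiable one_ne_zero _), real_inner_smul_left] at key
    exact key

lemma integral_fderiv_apply_eq_zero {φ : V → ℝ} (hφ : ContDiff ℝ 1 φ) (hc : HasCompactSupport φ)
    (v : V) : ∫ p, fderiv ℝ φ p v = 0 := by
  have hcont : Continuous fun p => fderiv ℝ φ p v :=
    (hφ.continuous_fderiv one_ne_zero).clm_apply continuous_const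
  have := integral_mul_fderiv_eq_neg_fderiv_mul_of_integrable (μ := (volume : Measure V)) (v := v)
    (f := fun _ : V => (1 : ℝ)) (g := φ) (by simp)
    (by simpa using hcont.integrable_of_hasCompactSupport (hc.fderiv_apply ℝ v))
    (by simpa using hφ.continuous.integrable_of_hasCompactSupport hc)
    (by fun_prop) (fun _ _ => hφ.differentiable one_ne_zero _)
  simpa using this

lemma integrable_fderiv_apply {φ : V → ℝ} (hφ : ContDiff ℝ 1 φ) (hc : HasCompactSupport φ)
    (v : V) : Integrable (fun p => fderiv ℝ φ p v) :=
  ((hφ.continuous_fderiv one_ne_zero).clm_apply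
    continuous_const).integrable_of_hasCompactSupport (hc.fderiv_apply ℝ v)

namespace IsGaussGreen

variable {E : Set V} {m : Measure V} {σ : V → V}

lemma compl (h : IsGaussGreen E m σ) : IsGaussGreen Eᶜ m (fun p => -σ p) where
  measurableSet := h.measurableSet.compl
  locallyFinite := h.locallyFinite
  measurable := h.measurable.neg
  norm_eq_one := by simpa using h.norm_eq_one
  setIntegral_fderiv φ hφ hc v := by
    have := integral_add_compl h.measurableSet (integrable_fderiv_apply hφ hc v)
    rw [integral_fderiv_apply_eq_zero hφ hc v, h.setIntegral_fderiv φ hφ hc v] at this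
    simp only [inner_neg_right, mul_neg, integral_neg]
    linarith

lemma measure_ball_lt_top (h : IsGaussGreen E m σ) (p : V) (r : ℝ) : m (ball p r) < ⊤ :=
  haveI := h.locallyFinite
  MeasureTheory.measure_ball_lt_top

lemma ae_abs_inner_le (h : IsGaussGreen E m σ) (v : V) : ∀ᵐ p ∂m, |inner ℝ v (σ p)| ≤ ‖v‖ := by
  filter_upwards [h.norm_eq_one] with p hp
  simpa [hp] using abs_real_inner_le_norm v (σ p)

lemma measurable_inner (h : IsGaussGreen E m σ) (v : V) : Measurable fun p => inner ℝ v (σ p) :=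
  measurable_const.inner h.measurable

lemma integrableOn_inner (h : IsGaussGreen E m σ) (v p : V) (r : ℝ) :
    IntegrableOn (fun q => inner ℝ v (σ q)) (ball p r) m :=
  Measure.integrableOn_of_bounded (M := ‖v‖) (h.measure_ball_lt_top p r).ne
    (h.measurable_inner v).aestronglyMeasurable (ae_restrict_of_ae (h.ae_abs_inner_le v))

lemma integrableOn_one (h : IsGaussGreen E m σ) (p : V) (r : ℝ) :
    IntegrableOn (fun _ => (1 : ℝ)) (ball p r) m :=
  integrableOn_const (h.measure_ball_lt_top p r).ne

end IsGaussGreen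

lemma real_volume_ball (p : V) {r : ℝ} (hr : 0 < r) :
    volume.real (ball p r) = r ^ finrank ℝ V * volume.real (ball (0 : V) 1) := by
  rw [measureReal_def, Measure.addHaar_ball_of_pos _ _ hr, ENNReal.toReal_mul,
    ENNReal.toReal_ofReal (by positivity), measureReal_def]

lemma real_volume_unit_ball_pos : 0 < volume.real (ball (0 : V) 1) :=
  ENNReal.toReal_pos (measure_ball_pos _ _ one_pos).ne' MeasureTheory.measure_ball_lt_top.ne

/-! ### A radial cutoff -/

lemma hasDerivAt_max_zero_sq (u : ℝ) : HasDerivAt (fun u : ℝ => max u 0 ^ 2) (2 * max u 0) u := by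
  rcases lt_trichotomy u 0 with hu | rfl | hu
  · rw [max_eq_right hu.le, mul_zero]
    refine (hasDerivAt_const u (0 : ℝ)).congr_of_eventuallyEq ?_
    filter_upwards [Iio_mem_nhds hu] with x hx
    simp [max_eq_right (mem_Iio.1 hx).le]
  · rw [hasDerivAt_iff_isLittleO]
    simp only [max_self, ne_eq, OfNat.ofNat_ne_zero, not_false_eq_true, zero_pow, sub_zero,
      mul_zero, smul_zero]
    refine Asymptotics.IsBigO.trans_isLittleO (g := fun x : ℝ => x ^ 2) ?_
      (by simpa using Asymptotics.isLittleO_pow_id (𝕜 := ℝ) one_lt_two)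
    refine Asymptotics.IsBigO.of_bound 1 (Eventually.of_forall fun x => ?_)
    rcases le_total x 0 with hx | hx <;> simp [hx]
    positivity
  · rw [max_eq_left hu.le]
    refine HasDerivAt.congr_of_eventuallyEq (f := fun u : ℝ => u ^ 2)
      (by simpa using hasDerivAt_pow 2 u) ?_
    filter_upwards [Ioi_mem_nhds hu] with x hx
    simp [max_eq_left (mem_Ioi.1 hx).le]

lemma contDiff_max_zero_sq : ContDiff ℝ 1 fun u : ℝ => max u 0 ^ 2 := by
  rw [contDiff_one_iff_deriv]
  refine ⟨fun u => (hasDerivAt_max_zero_sq u).differentiableAt, ?_⟩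
  rw [show deriv (fun u : ℝ => max u 0 ^ 2) = fun u => 2 * max u 0 from
    funext fun u => (hasDerivAt_max_zero_sq u).deriv]
  fun_prop

/-- The cutoff `((t² - |x - p|²)⁺)²`; its superlevel sets are balls around `p`. -/
def radialCutoff (p : V) (t : ℝ) (x : V) : ℝ := max (t ^ 2 - ‖x - p‖ ^ 2) 0 ^ 2

lemma contDiff_radialCutoff (p : V) (t : ℝ) : ContDiff ℝ 1 (radialCutoff p t) :=
  contDiff_max_zero_sq.comp (contDiff_const.sub ((contDiff_id.sub contDiff_const).norm_sq ℝ))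

lemma fderiv_radialCutoff (p : V) (t : ℝ) (x v : V) :
    fderiv ℝ (radialCutoff p t) x v
      = -4 * max (t ^ 2 - ‖x - p‖ ^ 2) 0 * inner ℝ (x - p) v := by
  have h1 : HasFDerivAt (fun x : V => t ^ 2 - ‖x - p‖ ^ 2) (-(2 • innerSL ℝ (x - p))) x := by
    have := ((hasFDerivAt_id x).sub_const p).norm_sq
    simpa using this.const_sub (t ^ 2)
  have h2 := (hasDerivAt_max_zero_sq (t ^ 2 - ‖x - p‖ ^ 2)).comp_hasFDerivAt x h1
  have h3 : HasFDerivAt (radialCutoff p t) _ x := h2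
  rw [h3.fderiv]
  simp [inner_sub_left]
  ring

lemma radialCutoff_eq_zero {p : V} {t : ℝ} (ht : 0 < t) {x : V} (hx : x ∉ ball p t) :
    max (t ^ 2 - ‖x - p‖ ^ 2) 0 = 0 := by
  rw [mem_ball, dist_eq_norm, not_lt] at hx
  apply max_eq_right
  nlinarith

lemma hasCompactSupport_radialCutoff (p : V) {t : ℝ} (ht : 0 < t) :
    HasCompactSupport (radialCutoff p t) :=
  HasCompactSupport.intro (isCompact_closedBall p t) fun x hx => by
    rw [radialCutoff, radialCutoff_eq_zero ht fun h => hx (ball_subset_closedBall h)]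
    simp

lemma abs_fderiv_radialCutoff_le {p : V} {t : ℝ} (ht : 0 < t) {x v : V} (hv : ‖v‖ ≤ 1) :
    |fderiv ℝ (radialCutoff p t) x v| ≤ (ball p t).indicator (fun _ => 4 * t ^ 3) x := by
  rw [fderiv_radialCutoff]
  by_cases hx : x ∈ ball p t
  · rw [indicator_of_mem hx, abs_mul, abs_mul]
    rw [mem_ball, dist_eq_norm] at hx
    have h1 : |inner ℝ (x - p) v| ≤ t := by
      refine (abs_real_inner_le_norm _ _).trans ?_
      nlinarith [norm_nonneg (x - p), norm_nonneg v]
    have h2 : |max (t ^ 2 - ‖x - p‖ ^ 2) 0| ≤ t ^ 2 := by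
      rw [abs_of_nonneg (le_max_right _ _)]
      exact max_le (by nlinarith [norm_nonneg (x - p)]) (by positivity)
    calc |(-4 : ℝ)| * |max (t ^ 2 - ‖x - p‖ ^ 2) 0| * |inner ℝ (x - p) v|
        ≤ 4 * t ^ 2 * t := by
          gcongr
          norm_num
      _ = 4 * t ^ 3 := by ring
  · rw [indicator_of_notMem hx, radialCutoff_eq_zero ht hx]
    simp

lemma setOf_lt_radialCutoff (p : V) {t : ℝ} (ht : 0 < t) {l : ℝ} (hl : 0 ≤ l) :
    ∃ r ≤ t, {x | l < radialCutoff p t x} = ball p r := by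
  refine ⟨√(t ^ 2 - √l), Real.sqrt_le_iff.2 <| .intro ht.le (by linarith [Real.sqrt_nonneg l]), ?_⟩
  ext x
  rw [mem_ofPred_eq, mem_ball, dist_eq_norm, radialCutoff, Real.lt_sqrt (norm_nonneg _),
    ← Real.sqrt_lt_sqrt_iff hl, Real.sqrt_sq (le_max_right _ _), lt_max_iff]
  constructor
  · rintro (h | h)
    · linarith
    · exact absurd h (Real.sqrt_nonneg l).not_gt
  · intro h
    left
    linarith

/-! ### Perimeter is controlled by volume where the normal is nearly constant -/

/-- On the ball `B`, the mean deviation `1 - ν · σ` of `σ` from `ν` is at most `ε`. -/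
def TiltLE (m : Measure V) (σ : V → V) (ν : V) (ε : ℝ) (B : Set V) : Prop :=
  ∫ q in B, (1 - inner ℝ ν (σ q)) ∂m ≤ ε * m.real B

namespace IsGaussGreen

variable {E : Set V} {m : Measure V} {σ : V → V}

lemma integrableOn_tilt (h : IsGaussGreen E m σ) (ν p : V) (r : ℝ) :
    IntegrableOn (fun q => 1 - inner ℝ ν (σ q)) (ball p r) m :=
  (h.integrableOn_one p r).sub (h.integrableOn_inner ν p r)

lemma tilt_nonneg (h : IsGaussGreen E m σ) {ν : V} (hν : ‖ν‖ = 1) :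
    ∀ᵐ q ∂m, 0 ≤ 1 - inner ℝ ν (σ q) := by
  filter_upwards [h.ae_abs_inner_le ν] with q hq
  rw [hν] at hq
  linarith [le_abs_self (inner ℝ ν (σ q))]

/-- The layer cake formula transfers the bound on the tilt from balls to the radial cutoff. -/
lemma lintegral_radialCutoff_tilt_le (h : IsGaussGreen E m σ) {ν p : V} (hν : ‖ν‖ = 1) {t : ℝ}
    (ht : 0 < t) (htilt : ∀ r ≤ t, TiltLE m σ ν (1 / 2) (ball p r)) :
    ∫⁻ q, ENNReal.ofReal (radialCutoff p t q) * ENNReal.ofReal (1 - inner ℝ ν (σ q)) ∂m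
      ≤ ENNReal.ofReal (1 / 2) * ∫⁻ q, ENNReal.ofReal (radialCutoff p t q) ∂m := by
  have hcont := (contDiff_radialCutoff p t).continuous
  have hnn : ∀ q, 0 ≤ radialCutoff p t q := fun q => sq_nonneg _
  have hw : Measurable fun q => ENNReal.ofReal (1 - inner ℝ ν (σ q)) :=
    (measurable_const.sub (h.measurable_inner ν)).ennreal_ofReal
  have hlhs : ∫⁻ q, ENNReal.ofReal (radialCutoff p t q) * ENNReal.ofReal (1 - inner ℝ ν (σ q)) ∂m
      = ∫⁻ q, ENNReal.ofReal (radialCutoff p t q)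
          ∂(m.withDensity fun q => ENNReal.ofReal (1 - inner ℝ ν (σ q))) := by
    rw [lintegral_withDensity_eq_lintegral_mul _ hw hcont.measurable.ennreal_ofReal]
    exact lintegral_congr fun q => mul_comm _ _
  rw [hlhs, lintegral_eq_lintegral_meas_lt _ (Eventually.of_forall hnn) hcont.aemeasurable,
    lintegral_eq_lintegral_meas_lt _ (Eventually.of_forall hnn) hcont.aemeasurable,
    ← lintegral_const_mul' _ _ ENNReal.ofReal_ne_top]
  refine setLIntegral_mono' measurableSet_Ioi fun l hl => ?_
  obtain ⟨r, hr, hball⟩ := setOf_lt_radialCutoff p ht (mem_Ioi.1 hl).le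
  rw [hball, withDensity_apply _ measurableSet_ball, ← ofReal_integral_eq_lintegral_ofReal
    (h.integrableOn_tilt ν p r) (ae_restrict_of_ae (h.tilt_nonneg hν)),
    ← ENNReal.ofReal_toReal (h.measure_ball_lt_top p r).ne, ← ENNReal.ofReal_mul (by norm_num)]
  exact ENNReal.ofReal_le_ofReal (htilt r hr)

lemma integrable_radialCutoff_mul (h : IsGaussGreen E m σ) (p : V) {t : ℝ} (ht : 0 < t)
    {f : V → ℝ} (hf : Measurable f) {C : ℝ} (hC : ∀ᵐ q ∂m, |f q| ≤ C) :
    Integrable (fun q => radialCutoff p t q * f q) m := by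
  have := h.locallyFinite
  exact ((contDiff_radialCutoff p t).continuous.integrable_of_hasCompactSupport
    (hasCompactSupport_radialCutoff p ht)).mul_bdd hf.aestronglyMeasurable hC

lemma integral_radialCutoff_le (h : IsGaussGreen E m σ) {ν p : V} (hν : ‖ν‖ = 1) {t : ℝ}
    (ht : 0 < t) (htilt : ∀ r ≤ t, TiltLE m σ ν (1 / 2) (ball p r)) :
    ∫ q, radialCutoff p t q ∂m ≤ 2 * ∫ q, radialCutoff p t q * inner ℝ ν (σ q) ∂m := by
  have hnn : ∀ q, 0 ≤ radialCutoff p t q := fun q => sq_nonneg _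
  have hi1 : Integrable (radialCutoff p t) m := by
    have := h.locallyFinite
    exact (contDiff_radialCutoff p t).continuous.integrable_of_hasCompactSupport
      (hasCompactSupport_radialCutoff p ht)
  have hi2 := h.integrable_radialCutoff_mul p ht (h.measurable_inner ν) (h.ae_abs_inner_le ν)
  have hi3 : Integrable (fun q => radialCutoff p t q * (1 - inner ℝ ν (σ q))) m := by
    simp_rw [mul_sub, mul_one]
    exact hi1.sub hi2
  have key := h.lintegral_radialCutoff_tilt_le hν ht htilt
  simp_rw [← ENNReal.ofReal_mul (hnn _)] at key
  rw [← ofReal_integral_eq_lintegral_ofReal hi3 (by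
      filter_upwards [h.tilt_nonneg hν] with q hq using mul_nonneg (hnn q) hq),
    ← ofReal_integral_eq_lintegral_ofReal hi1 (Eventually.of_forall hnn),
    ← ENNReal.ofReal_mul (by norm_num), ENNReal.ofReal_le_ofReal_iff
      (mul_nonneg (by norm_num) (integral_nonneg hnn))] at key
  have : ∫ q, radialCutoff p t q * (1 - inner ℝ ν (σ q)) ∂m
      = (∫ q, radialCutoff p t q ∂m) - ∫ q, radialCutoff p t q * inner ℝ ν (σ q) ∂m := by
    rw [← integral_sub hi1 hi2]
    exact integral_congr_ae (Eventually.of_forall fun q => by simp only []; ring)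
  linarith

/-- A Caccioppoli-type inequality, from the Gauss–Green formula for the field `φ ν` with `φ` the
radial cutoff. -/
lemma perimeter_le_volume (h : IsGaussGreen E m σ) {ν p : V} (hν : ‖ν‖ = 1) {s t : ℝ}
    (hs : 0 < s) (hst : s < t) (htilt : ∀ r ≤ t, TiltLE m σ ν (1 / 2) (ball p r)) :
    (t - s) ^ 2 * m.real (ball p s) ≤ 8 * t * volume.real (E ∩ ball p t) := by
  have ht : 0 < t := hs.trans hst
  have hnn : ∀ q, 0 ≤ radialCutoff p t q := fun q => sq_nonneg _
  have hi1 : Integrable (radialCutoff p t) m := by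
    have := h.locallyFinite
    exact (contDiff_radialCutoff p t).continuous.integrable_of_hasCompactSupport
      (hasCompactSupport_radialCutoff p ht)
  have h1 : (t * (t - s)) ^ 2 * m.real (ball p s) ≤ ∫ q, radialCutoff p t q ∂m := by
    calc (t * (t - s)) ^ 2 * m.real (ball p s)
        = ∫ q in ball p s, (t * (t - s)) ^ 2 ∂m := by
          rw [setIntegral_const, smul_eq_mul, mul_comm]
      _ ≤ ∫ q in ball p s, radialCutoff p t q ∂m := by
          refine setIntegral_mono_on (integrableOn_const (h.measure_ball_lt_top p s).ne)
            hi1.integrableOn measurableSet_ball fun q hq => ?_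
          rw [mem_ball, dist_eq_norm] at hq
          have : 0 ≤ t - s := by linarith
          refine pow_le_pow_left₀ (by positivity) (le_max_of_le_left ?_) 2
          nlinarith [norm_nonneg (q - p)]
      _ ≤ _ := setIntegral_le_integral hi1 (Eventually.of_forall hnn)
  have h2 := h.integral_radialCutoff_le hν ht htilt
  have h3 := h.setIntegral_fderiv _ (contDiff_radialCutoff p t)
    (hasCompactSupport_radialCutoff p ht) ν
  have h4 : -∫ q in E, fderiv ℝ (radialCutoff p t) q ν
      ≤ 4 * t ^ 3 * volume.real (E ∩ ball p t) := by
    refine (neg_le_abs _).trans ((abs_integral_le_integral_abs).trans ?_)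
    calc ∫ q in E, |fderiv ℝ (radialCutoff p t) q ν|
        ≤ ∫ q in E, (ball p t).indicator (fun _ => 4 * t ^ 3) q := by
          refine integral_mono
            (integrable_fderiv_apply (contDiff_radialCutoff p t)
              (hasCompactSupport_radialCutoff p ht) ν).abs.integrableOn ?_
            fun q => abs_fderiv_radialCutoff_le ht hν.le
          exact ((integrable_indicator_iff measurableSet_ball).2
            (integrableOn_const MeasureTheory.measure_ball_lt_top.ne)).integrableOn
      _ = _ := by
          rw [setIntegral_indicator measurableSet_ball, setIntegral_const, smul_eq_mul, mul_comm]
  have h5 : t ^ 2 * ((t - s) ^ 2 * m.real (ball p s))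
      ≤ t ^ 2 * (8 * t * volume.real (E ∩ ball p t)) := by nlinarith
  exact le_of_mul_le_mul_left h5 (by positivity)

/-! ### The change of a set under translation -/

/-- The translation estimate tested with a smooth cutoff `ψ`: along `t ↦ ∫_E ψ(· - t a)` the
derivative is given by the Gauss–Green formula. -/
lemma setIntegral_translate_le (h : IsGaussGreen E m σ) {p a : V} {s : ℝ} {ψ : V → ℝ}
    (hψ : ContDiff ℝ 1 ψ) (hc : HasCompactSupport ψ) (h0 : ∀ x, 0 ≤ ψ x) (h1 : ∀ x, ψ x ≤ 1)
    (hs : ∀ x, x ∉ ball p s → ψ x = 0) :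
    (∫ x in E, ψ x) - ∫ x in E, ψ (x - a)
      ≤ ∫ x in ball p (s + ‖a‖), max (-inner ℝ a (σ x)) 0 ∂m := by
  have hψt : ∀ t : ℝ, ContDiff ℝ 1 fun x => ψ (x - t • a) := fun t =>
    hψ.comp (contDiff_id.sub contDiff_const)
  have hct : ∀ t : ℝ, HasCompactSupport fun x => ψ (x - t • a) := fun t =>
    hc.comp_homeomorph (Homeomorph.subRight (t • a))
  have hfd : ∀ (t : ℝ) (x : V), fderiv ℝ (fun x => ψ (x - t • a)) x = fderiv ℝ ψ (x - t • a) :=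
    fun t x => fderiv_comp_sub (t • a)
  obtain ⟨C, hC⟩ := (hc.fderiv (𝕜 := ℝ)).exists_bound_of_continuous
    (hψ.continuous_fderiv one_ne_zero)
  have hderiv : ∀ t : ℝ, HasDerivAt (fun t : ℝ => ∫ x in E, ψ (x - t • a))
      (∫ x, ψ (x - t • a) * inner ℝ a (σ x) ∂m) t := by
    intro t
    have key := (hasDerivAt_integral_of_dominated_loc_of_deriv_le (μ := volume.restrict E)
      (F := fun (t : ℝ) x => ψ (x - t • a))
      (F' := fun t x => fderiv ℝ ψ (x - t • a) (-a))
      (x₀ := t) (s := ball t 1)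
      (bound := (ball p (s + (|t| + 1) * ‖a‖ + 1)).indicator fun _ => C * ‖a‖)
      (ball_mem_nhds t one_pos)
      (Eventually.of_forall fun t => (hψt t).continuous.aestronglyMeasurable)
      ((hψt t).continuous.integrable_of_hasCompactSupport (hct t)).integrableOn
      ?_ ?_ ?_ ?_).2
    · have := h.setIntegral_fderiv _ (hψt t) (hct t) (-a)
      simp_rw [hfd] at this
      rw [this] at key
      simpa [integral_neg] using key
    · exact (((hψ.continuous_fderiv one_ne_zero).comp
        (by fun_prop : Continuous fun x => x - t • a)).clm_apply
        continuous_const).aestronglyMeasurable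
    · refine Eventually.of_forall fun x r hr => ?_
      by_cases hx : x ∈ ball p (s + (|t| + 1) * ‖a‖ + 1)
      · rw [indicator_of_mem hx]
        refine (ContinuousLinearMap.le_opNorm _ _).trans ?_
        rw [norm_neg]
        gcongr
        exact hC _
      · rw [indicator_of_notMem hx]
        have hx' : x - r • a ∉ tsupport ψ := by
          intro hmem
          have h2 : tsupport ψ ⊆ closedBall p s := closure_minimal (fun y hy => by
            by_contra hy'
            exact hy (hs y fun h => hy' (ball_subset_closedBall h))) isClosed_closedBall
          have h3 := h2 hmem
          rw [mem_closedBall, dist_eq_norm] at h3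
          rw [mem_ball, dist_eq_norm] at hx
          apply hx
          have h4 : |r| ≤ |t| + 1 := by
            rw [mem_ball, Real.dist_eq] at hr
            have := abs_sub_abs_le_abs_sub r t
            linarith
          calc ‖x - p‖ = ‖(x - r • a - p) + r • a‖ := by congr 1; abel
            _ ≤ ‖x - r • a - p‖ + ‖r • a‖ := norm_add_le _ _
            _ ≤ s + (|t| + 1) * ‖a‖ := by
                rw [norm_smul, Real.norm_eq_abs]
                gcongr
            _ < _ := by linarith
        rw [fderiv_of_notMem_tsupport (𝕜 := ℝ) hx']
        simp
    · exact ((integrable_indicator_iff measurableSet_ball).2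
            (integrableOn_const MeasureTheory.measure_ball_lt_top.ne)).integrableOn
    · refine Eventually.of_forall fun x r _ => ?_
      have h1 : HasDerivAt (fun r : ℝ => x - r • a) (-a) r := by
        simpa using ((hasDerivAt_id r).smul_const a).const_sub x
      exact ((hψ.differentiable one_ne_zero _).hasFDerivAt).comp_hasDerivAt r h1
  have hge : ∀ t ∈ interior (Icc (0 : ℝ) 1),
      -∫ x in ball p (s + ‖a‖), max (-inner ℝ a (σ x)) 0 ∂m
        ≤ deriv (fun t : ℝ => ∫ x in E, ψ (x - t • a)) t := by
    intro t ht
    rw [interior_Icc] at ht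
    rw [(hderiv t).deriv, neg_le, ← integral_neg, ← integral_indicator measurableSet_ball]
    have := h.locallyFinite
    refine integral_mono (((hψt t).continuous.integrable_of_hasCompactSupport (hct t)).mul_bdd
      (h.measurable_inner a).aestronglyMeasurable (h.ae_abs_inner_le a)).neg
      ((integrable_indicator_iff measurableSet_ball).2 (h.integrableOn_inner a _ _).neg.pos_part)
      fun x => ?_
    by_cases hx : x ∈ ball p (s + ‖a‖)
    · rw [indicator_of_mem hx]
      simp only []
      rw [← mul_neg]
      calc ψ (x - t • a) * -inner ℝ a (σ x) ≤ ψ (x - t • a) * max (-inner ℝ a (σ x)) 0 :=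
            mul_le_mul_of_nonneg_left (le_max_left _ _) (h0 _)
        _ ≤ 1 * max (-inner ℝ a (σ x)) 0 :=
            mul_le_mul_of_nonneg_right (h1 _) (le_max_right _ _)
        _ = _ := one_mul _
    · rw [indicator_of_notMem hx]
      rw [hs (x - t • a)]
      · simp
      · intro hmem
        rw [mem_ball, dist_eq_norm] at hmem hx
        apply hx
        calc ‖x - p‖ = ‖(x - t • a - p) + t • a‖ := by congr 1; abel
          _ ≤ ‖x - t • a - p‖ + ‖t • a‖ := norm_add_le _ _
          _ < s + ‖a‖ := by
            rw [norm_smul, Real.norm_eq_abs, abs_of_pos ht.1]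
            nlinarith [norm_nonneg a, ht.2]
  have := (convex_Icc (0 : ℝ) 1).mul_sub_le_image_sub_of_le_deriv
    (fun t _ => (hderiv t).continuousAt.continuousWithinAt)
    (fun t _ => (hderiv t).differentiableAt.differentiableWithinAt) hge 0 (by simp) 1 (by simp)
    zero_le_one
  simp only [one_smul, zero_smul, sub_zero, mul_one] at this
  linarith

/-- The part of `E ∩ B` that leaves `E` under the translation by `a` is controlled by the
perimeter on which the inner normal points against `a`. -/
lemma volume_translate_le (h : IsGaussGreen E m σ) (p a : V) (s : ℝ) :
    volume.real {x | x ∈ E ∩ ball p s ∧ x + a ∉ E}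
      ≤ ∫ x in ball p (s + ‖a‖), max (-inner ℝ a (σ x)) 0 ∂m := by
  set A : Set V := {x | x ∈ E ∩ ball p s ∧ x + a ∉ E} with hA
  have hAsub : A ⊆ ball p s := fun x hx => hx.1.2
  have hAmeas : MeasurableSet A :=
    (h.measurableSet.inter measurableSet_ball).inter
      ((measurable_add_const a) h.measurableSet).compl
  have hAtop : volume A ≠ ⊤ :=
    ((measure_mono hAsub).trans_lt MeasureTheory.measure_ball_lt_top).ne
  refine le_of_forall_pos_le_add fun ε hε => ?_
  -- a smooth `ψ` that approximates the characteristic function of `A` in `L¹`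
  obtain ⟨K, hKA, hK, hKε⟩ := hAmeas.exists_isCompact_sdiff_lt hAtop
    (ε := ENNReal.ofReal (ε / 2)) (by simpa using hε)
  obtain ⟨U, hAU, hU, hUtop, hUε⟩ := hAmeas.exists_isOpen_sdiff_lt hAtop
    (ε := ENNReal.ofReal (ε / 2)) (by simpa using hε)
  obtain ⟨ψ, hψ, hrange, hsupp, hone⟩ := exists_contMDiff_support_eq_eq_one_iff (n := 1)
    (modelWithCornersSelf ℝ V) (hU.inter (isOpen_ball (x := p) (ε := s))) hK.isClosed
    (hKA.trans (subset_inter hAU hAsub))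
  have hψ' : ContDiff ℝ 1 ψ := hψ.contDiff
  have h0 : ∀ x, 0 ≤ ψ x := fun x => (hrange (mem_range_self x)).1
  have h1 : ∀ x, ψ x ≤ 1 := fun x => (hrange (mem_range_self x)).2
  have hz : ∀ x, x ∉ U ∩ ball p s → ψ x = 0 := fun x hx => by
    rwa [← hsupp, Function.notMem_support] at hx
  have hc : HasCompactSupport ψ := HasCompactSupport.intro (isCompact_closedBall p s)
    fun x hx => hz x fun h => hx (ball_subset_closedBall h.2)
  have hψi : Integrable ψ := hψ'.continuous.integrable_of_hasCompactSupport hc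
  have key := h.setIntegral_translate_le (a := a) hψ' hc h0 h1
    (fun x hx => hz x fun h => hx h.2)
  have e1 : ∫ x in E, ψ (x - a) = ∫ x in (fun x => x + a) ⁻¹' E, ψ x := by
    have hmp := measurePreserving_add_right (volume : Measure V) a
    rw [← hmp.setIntegral_preimage_emb (measurableEmbedding_addRight a) (fun x => ψ (x - a)) E]
    simp
  have e2 : (∫ x in E, ψ x) - ∫ x in E, ψ (x - a)
      = ∫ x, (E.indicator ψ x - ((fun x => x + a) ⁻¹' E).indicator ψ x) := by
    rw [e1, ← integral_indicator h.measurableSet,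
      ← integral_indicator ((measurable_add_const a) h.measurableSet), integral_sub]
    · exact hψi.indicator h.measurableSet
    · exact hψi.indicator ((measurable_add_const a) h.measurableSet)
  have hiK : Integrable (K.indicator fun _ => (1 : ℝ)) :=
    (integrable_indicator_iff hK.measurableSet).2 (integrableOn_const hK.measure_lt_top.ne)
  have hUA : MeasurableSet (U \ A) := hU.measurableSet.diff hAmeas
  have hiU : Integrable ((U \ A).indicator fun _ => (1 : ℝ)) :=
    (integrable_indicator_iff hUA).2 (integrableOn_const (hUε.trans ENNReal.ofReal_lt_top).ne)
  have e3 : volume.real K - volume.real (U \ A) ≤ (∫ x in E, ψ x) - ∫ x in E, ψ (x - a) := by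
    rw [e2, ← integral_indicator_one hK.measurableSet, ← integral_indicator_one hUA]
    change (∫ x, K.indicator (fun _ => (1 : ℝ)) x) - ∫ x, (U \ A).indicator (fun _ => (1 : ℝ)) x ≤ _
    rw [← integral_sub hiK hiU]
    refine integral_mono (hiK.sub hiU)
      ((hψi.indicator h.measurableSet).sub
        (hψi.indicator ((measurable_add_const a) h.measurableSet))) fun x => ?_
    by_cases hxU : x ∈ U
    · by_cases hxA : x ∈ A
      · have hxE : x ∈ E := hxA.1.1
        have hxE' : x + a ∉ E := hxA.2
        by_cases hxK : x ∈ K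
        · simp [hxK, hxA, hxE, hxE', ((hone x).1 hxK)]
        · simp [hxK, hxA, hxE, hxE', h0 x]
      · have hxK : x ∉ K := fun h => hxA (hKA h)
        by_cases hxE : x ∈ E <;> by_cases hxE' : x + a ∈ E <;>
          simp [hxK, hxA, hxU, hxE, hxE'] <;> linarith [h0 x, h1 x]
    · have hxK : x ∉ K := fun h => hxU (hAU (hKA h))
      have hψ0 : ψ x = 0 := hz x fun h => hxU h.1
      simp [hxK, hxU, indicator, hψ0]
  have e4 : volume.real (U \ A) ≤ ε / 2 :=
    ENNReal.toReal_le_of_le_ofReal (by positivity) hUε.le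
  have e5 : volume.real (A \ K) ≤ ε / 2 :=
    ENNReal.toReal_le_of_le_ofReal (by positivity) hKε.le
  have e6 : volume.real A ≤ volume.real K + volume.real (A \ K) := by
    have := measureReal_union_le (μ := volume) K (A \ K)
    rwa [union_sdiff_cancel hKA] at this
  linarith

end IsGaussGreen

/-! ### Density estimates -/

/-- Two ways of measuring the set of pairs `(x, a) ∈ A × D` with `x + a ∈ C`. -/
lemma mul_volume_le_of_translate_le {A C D : Set V} (hA : MeasurableSet A) (hC : MeasurableSet C)
    (hD : MeasurableSet D) (hAtop : volume A ≠ ⊤) (hDtop : volume D ≠ ⊤) {c K : ℝ} (hK : 0 ≤ K)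
    (hc : ∀ x ∈ A, c ≤ volume.real {a | a ∈ D ∧ x + a ∈ C})
    (hCK : ∀ a ∈ D, volume.real {x | x ∈ A ∧ x + a ∈ C} ≤ K) :
    c * volume.real A ≤ K * volume.real D := by
  set S : Set (V × V) := {q | q.1 ∈ A ∧ q.2 ∈ D ∧ q.1 + q.2 ∈ C} with hS
  have hSm : MeasurableSet S :=
    (measurable_fst hA).inter ((measurable_snd hD).inter ((measurable_fst.add measurable_snd) hC))
  have h1 : ENNReal.ofReal c * volume A ≤ (volume.prod volume) S := by
    rw [Measure.prod_apply hSm, ← setLIntegral_const]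
    refine (setLIntegral_mono' hA fun x hx => ?_).trans (setLIntegral_le_lintegral A _)
    have e : Prod.mk x ⁻¹' S = {a | a ∈ D ∧ x + a ∈ C} := by
      ext a
      simp [hS, hx]
    rw [e]
    exact ENNReal.ofReal_le_of_le_toReal (hc x hx)
  have h2 : (volume.prod volume) S ≤ ENNReal.ofReal K * volume D := by
    rw [Measure.prod_apply_symm hSm, ← setLIntegral_const, ← lintegral_indicator hD]
    refine lintegral_mono fun a => ?_
    by_cases ha : a ∈ D
    · have e : (fun x => (x, a)) ⁻¹' S = {x | x ∈ A ∧ x + a ∈ C} := by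
        ext x
        simp [hS, ha]
      rw [indicator_of_mem ha, e]
      exact (ENNReal.le_ofReal_iff_toReal_le
        ((measure_mono fun x hx => hx.1).trans_lt hAtop.lt_top).ne hK).2 (hCK a ha)
    · have e : (fun x => (x, a)) ⁻¹' S = ∅ := by
        ext x
        simp [hS, ha]
      rw [e]
      simp
  have h3 := ENNReal.toReal_mono (ENNReal.mul_ne_top ENNReal.ofReal_ne_top hDtop) (h1.trans h2)
  rw [ENNReal.toReal_mul, ENNReal.toReal_mul, ENNReal.toReal_ofReal hK] at h3
  exact (mul_le_mul_of_nonneg_right (le_max_left c 0) ENNReal.toReal_nonneg).trans h3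

/-- `p` is a point of the support of `m` at which the mean tilt of `σ` from the unit vector `ν` over
`B_r(p)` tends to zero with `r`. -/
structure IsReducedPoint (m : Measure V) (σ : V → V) (p ν : V) : Prop where
  norm_eq_one : ‖ν‖ = 1
  eventually_pos : ∀ᶠ r in 𝓝[>] (0 : ℝ), 0 < m.real (ball p r)
  eventually_tilt : ∀ ε > 0, ∀ᶠ r in 𝓝[>] (0 : ℝ), TiltLE m σ ν ε (ball p r)

lemma IsReducedPoint.neg {m : Measure V} {σ : V → V} {p ν : V} (h : IsReducedPoint m σ p ν) :
    IsReducedPoint m (fun q => -σ q) p (-ν) where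
  norm_eq_one := by simpa using h.norm_eq_one
  eventually_pos := h.eventually_pos
  eventually_tilt := by simpa [TiltLE] using h.eventually_tilt

lemma eventually_forall_le_of_eventually {P : ℝ → Prop} (h : ∀ᶠ r in 𝓝[>] (0 : ℝ), P r)
    (h0 : ∀ r ≤ 0, P r) : ∀ᶠ r in 𝓝[>] (0 : ℝ), ∀ s ≤ r, P s := by
  obtain ⟨d, hd, hP⟩ := mem_nhdsGT_iff_exists_Ioo_subset.1 h
  filter_upwards [Ioo_mem_nhdsGT hd] with r hr s hs
  rcases le_or_gt s 0 with hs0 | hs0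
  · exact h0 s hs0
  · exact hP ⟨hs0, hs.trans_lt hr.2⟩

lemma IsReducedPoint.eventually_forall_tilt {m : Measure V} {σ : V → V} {p ν : V}
    (h : IsReducedPoint m σ p ν) {ε : ℝ} (hε : 0 < ε) :
    ∀ᶠ r in 𝓝[>] (0 : ℝ), ∀ s ≤ r, TiltLE m σ ν ε (ball p s) :=
  eventually_forall_le_of_eventually (h.eventually_tilt ε hε) fun r hr => by
    simp [TiltLE, ball_eq_empty.2 hr]

lemma eventually_nhdsGT_zero_mul {P : ℝ → Prop} (h : ∀ᶠ r in 𝓝[>] (0 : ℝ), P r) {c : ℝ}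
    (hc : 0 < c) : ∀ᶠ r in 𝓝[>] (0 : ℝ), P (c * r) := by
  refine Tendsto.eventually ?_ h
  refine tendsto_nhdsWithin_iff.2 ⟨?_, ?_⟩
  · have : Tendsto (fun r : ℝ => c * r) (𝓝 0) (𝓝 (c * 0)) := (continuous_const_mul c).tendsto 0
    rw [mul_zero] at this
    exact this.mono_left nhdsWithin_le_nhds
  · filter_upwards [self_mem_nhdsWithin] with r hr using mul_pos hc hr

namespace IsGaussGreen

variable {E : Set V} {m : Measure V} {σ : V → V}

lemma measureReal_ball_mono (h : IsGaussGreen E m σ) (p : V) {r s : ℝ} (hrs : r ≤ s) :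
    m.real (ball p r) ≤ m.real (ball p s) :=
  measureReal_mono (ball_subset_ball hrs) (h.measure_ball_lt_top p s).ne

lemma volume_translate_le_norm_mul (h : IsGaussGreen E m σ) (p a : V) (s : ℝ) :
    volume.real {x | x ∈ E ∩ ball p s ∧ x + a ∉ E} ≤ ‖a‖ * m.real (ball p (s + ‖a‖)) := by
  refine (h.volume_translate_le p a s).trans ?_
  calc ∫ x in ball p (s + ‖a‖), max (-inner ℝ a (σ x)) 0 ∂m
      ≤ ∫ x in ball p (s + ‖a‖), ‖a‖ ∂m := by
        refine integral_mono_ae (h.integrableOn_inner a p _).neg.pos_part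
          (integrableOn_const (h.measure_ball_lt_top p _).ne) (ae_restrict_of_ae ?_)
        filter_upwards [h.ae_abs_inner_le a] with x hx
        exact max_le ((neg_le_abs _).trans hx) (norm_nonneg a)
    _ = _ := by rw [setIntegral_const, smul_eq_mul, mul_comm]

/-- A local isoperimetric inequality: when `E` fills at most half the volume of a ball of radius
`τ`, most translations by vectors shorter than `τ` carry a given point of `E` out of `E`. -/
lemma volume_le_perimeter (h : IsGaussGreen E m σ) {p : V} {s t τ : ℝ} (hτ : 0 < τ)
    (hst : s + τ ≤ t)
    (hV : volume.real (E ∩ ball p t) ≤ volume.real (ball (0 : V) 1) / 2 * τ ^ finrank ℝ V) :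
    volume.real (E ∩ ball p s) ≤ 2 * τ * m.real (ball p (s + τ)) := by
  set ω := volume.real (ball (0 : V) 1) with hω
  have hωpos : 0 < ω := real_volume_unit_ball_pos
  have hD : volume.real (ball (0 : V) τ) = τ ^ finrank ℝ V * ω := real_volume_ball 0 hτ
  have key := mul_volume_le_of_translate_le (A := E ∩ ball p s) (C := Eᶜ) (D := ball (0 : V) τ)
    (c := ω / 2 * τ ^ finrank ℝ V) (K := τ * m.real (ball p (s + τ)))
    (h.measurableSet.inter measurableSet_ball) h.measurableSet.compl measurableSet_ball
    ((measure_mono inter_subset_right).trans_lt MeasureTheory.measure_ball_lt_top).ne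
    MeasureTheory.measure_ball_lt_top.ne (by positivity) ?_ ?_
  · rw [hD] at key
    have hpos : 0 < ω / 2 * τ ^ finrank ℝ V := by positivity
    refine le_of_mul_le_mul_left (key.trans_eq ?_) hpos
    ring
  · intro x hx
    have h1 : volume.real {a | a ∈ ball (0 : V) τ ∧ x + a ∈ E} ≤ volume.real (E ∩ ball p t) := by
      have e : volume.real ((fun a => x + a) ⁻¹' (E ∩ ball p t)) = volume.real (E ∩ ball p t) := by
        rw [measureReal_def, measure_preimage_add, measureReal_def]
      rw [← e]
      refine measureReal_mono (fun a ha => ⟨ha.2, ?_⟩) ?_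
      · have h2 := ha.1
        have h3 := hx.2
        rw [mem_ball, dist_eq_norm] at h3 ⊢
        rw [mem_ball, dist_zero_right] at h2
        calc ‖x + a - p‖ = ‖(x - p) + a‖ := by congr 1; abel
          _ ≤ ‖x - p‖ + ‖a‖ := norm_add_le _ _
          _ < t := by linarith
      · rw [measure_preimage_add]
        exact ((measure_mono inter_subset_right).trans_lt MeasureTheory.measure_ball_lt_top).ne
    have h2 : volume.real (ball (0 : V) τ) ≤ volume.real {a | a ∈ ball (0 : V) τ ∧ x + a ∈ E}
        + volume.real {a | a ∈ ball (0 : V) τ ∧ x + a ∈ Eᶜ} := by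
      refine (measureReal_mono (fun a ha => ?_) ?_).trans (measureReal_union_le _ _)
      · by_cases hxa : x + a ∈ E
        · exact Or.inl ⟨ha, hxa⟩
        · exact Or.inr ⟨ha, hxa⟩
      · refine ((measure_mono (t := ball (0 : V) τ) ?_).trans_lt
          MeasureTheory.measure_ball_lt_top).ne
        rintro a (ha | ha) <;> exact ha.1
    rw [hD] at h2
    linarith
  · intro a ha
    rw [mem_ball, dist_zero_right] at ha
    refine (h.volume_translate_le_norm_mul p a s).trans ?_
    exact mul_le_mul ha.le (h.measureReal_ball_mono p (by linarith)) measureReal_nonneg hτ.le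

/-- One step of De Giorgi's iteration. The radii `ρ (1 + q) / 2` shrink linearly in `q` and the
translation lengths `κ ρ q²` quadratically, which balances the factor `q⁻²` lost in
`perimeter_le_volume`. -/
lemma volume_iteration_step (h : IsGaussGreen E m σ) {p ν : V} (hν : ‖ν‖ = 1) {ρ q : ℝ}
    (hρ : 0 < ρ) (hq : 0 < q) (hq1 : q ≤ 1)
    (htilt : ∀ r ≤ ρ, TiltLE m σ ν (1 / 2) (ball p r))
    (hV : volume.real (E ∩ ball p (ρ * (1 / 2 + q / 2))) ≤ volume.real (ball (0 : V) 1) / 2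
      * (1 / (1024 * 4 ^ finrank ℝ V) * ρ * q ^ 2) ^ finrank ℝ V) :
    volume.real (E ∩ ball p (ρ * (1 / 2 + q / 2 / 2))) ≤ volume.real (ball (0 : V) 1) / 2
      * (1 / (1024 * 4 ^ finrank ℝ V) * ρ * (q / 2) ^ 2) ^ finrank ℝ V := by
  set n := finrank ℝ V with hn
  set ω := volume.real (ball (0 : V) 1) with hω
  set κ : ℝ := 1 / (1024 * 4 ^ n) with hκ
  have hκpos : 0 < κ := by positivity
  have hκle : κ ≤ 1 / 8 := by
    rw [hκ]
    refine one_div_le_one_div_of_le (by norm_num) ?_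
    have : (1 : ℝ) ≤ 4 ^ n := one_le_pow₀ (by norm_num)
    linarith
  set v := volume.real (E ∩ ball p (ρ * (1 / 2 + q / 2))) with hv
  set τ := κ * ρ * q ^ 2 with hτ
  have hτpos : 0 < τ := by positivity
  have hτle : τ ≤ ρ * q / 8 := by
    have : q ^ 2 ≤ q := by nlinarith
    calc τ = κ * (ρ * q ^ 2) := by ring
      _ ≤ 1 / 8 * (ρ * q) := by gcongr
      _ = _ := by ring
  have h1 := h.volume_le_perimeter (s := ρ * (1 / 2 + q / 2 / 2)) hτpos (by nlinarith) hV
  have h2 := h.perimeter_le_volume hν (s := ρ * (1 / 2 + q / 2 / 2) + τ)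
    (t := ρ * (1 / 2 + q / 2)) (p := p) (by positivity) (by nlinarith)
    (fun r hr => htilt r (hr.trans (by nlinarith)))
  set M := m.real (ball p (ρ * (1 / 2 + q / 2 / 2) + τ)) with hM
  have hM0 : 0 ≤ M := measureReal_nonneg
  have hv0 : 0 ≤ v := measureReal_nonneg
  have h3 : (ρ * q / 8) ^ 2 * M ≤ 8 * ρ * v := by
    calc (ρ * q / 8) ^ 2 * M
        ≤ (ρ * (1 / 2 + q / 2) - (ρ * (1 / 2 + q / 2 / 2) + τ)) ^ 2 * M := by
          gcongr
          nlinarith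
      _ ≤ _ := h2
      _ ≤ _ := by
          gcongr
          nlinarith
  have h4 : ρ * q ^ 2 * M ≤ 512 * v := by
    have : ρ * (ρ * q ^ 2 * M) ≤ ρ * (512 * v) := by nlinarith
    exact le_of_mul_le_mul_left this hρ
  have h5 : 2 * τ * M ≤ 1 / 4 ^ n * v := by
    calc 2 * τ * M = 2 * κ * (ρ * q ^ 2 * M) := by ring
      _ ≤ 2 * κ * (512 * v) := by gcongr
      _ = _ := by
        rw [hκ]
        field_simp
        norm_num
  calc _ ≤ 1 / 4 ^ n * v := h1.trans h5
    _ ≤ 1 / 4 ^ n * (ω / 2 * τ ^ n) := by gcongr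
    _ = _ := by
      rw [show κ * ρ * (q / 2) ^ 2 = 1 / 4 * τ by rw [hτ]; ring, mul_pow (1 / 4), one_div_pow]
      ring

/-- De Giorgi's iteration: if `E` has small volume in a ball where its normal is nearly constant,
it has no volume at all in the concentric ball of half the radius. -/
lemma volume_half_ball_eq_zero (h : IsGaussGreen E m σ) {p ν : V} (hν : ‖ν‖ = 1) {ρ : ℝ}
    (hρ : 0 < ρ) (htilt : ∀ r ≤ ρ, TiltLE m σ ν (1 / 2) (ball p r))
    (hV : volume.real (E ∩ ball p ρ) ≤ volume.real (ball (0 : V) 1) / 2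
      * (1 / (1024 * 4 ^ finrank ℝ V)) ^ finrank ℝ V * ρ ^ finrank ℝ V) :
    volume.real (E ∩ ball p (ρ / 2)) = 0 := by
  have hn : finrank ℝ V ≠ 0 := by
    have : Nontrivial V := nontrivial_of_ne ν 0 (by rintro rfl; simp at hν)
    exact finrank_pos.ne'
  have hiter : ∀ j : ℕ, volume.real (E ∩ ball p (ρ * (1 / 2 + (1 / 2) ^ j / 2)))
      ≤ volume.real (ball (0 : V) 1) / 2
        * (1 / (1024 * 4 ^ finrank ℝ V) * ρ * ((1 / 2) ^ j) ^ 2) ^ finrank ℝ V := by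
    intro j
    induction j with
    | zero =>
      have e : ρ * (1 / 2 + (1 / 2) ^ 0 / 2) = ρ := by ring
      rw [e]
      refine hV.trans_eq ?_
      rw [pow_zero, one_pow, mul_one, mul_pow]
      ring
    | succ j ih =>
      rw [show (1 / 2 : ℝ) ^ (j + 1) = (1 / 2) ^ j / 2 by ring]
      exact h.volume_iteration_step hν hρ (by positivity)
        (pow_le_one₀ (by norm_num) (by norm_num)) htilt ih
  have hlim : Tendsto (fun j : ℕ => volume.real (ball (0 : V) 1) / 2
      * (1 / (1024 * 4 ^ finrank ℝ V) * ρ * ((1 / 2 : ℝ) ^ j) ^ 2) ^ finrank ℝ V) atTop (𝓝 0) := by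
    have h1 : Tendsto (fun j : ℕ => (1 / 2 : ℝ) ^ j) atTop (𝓝 0) :=
      tendsto_pow_atTop_nhds_zero_of_lt_one (by norm_num) (by norm_num)
    have h2 := (((h1.pow 2).const_mul (1 / (1024 * 4 ^ finrank ℝ V) * ρ)).pow
      (finrank ℝ V)).const_mul (volume.real (ball (0 : V) 1) / 2)
    simpa [hn] using h2
  refine le_antisymm (ge_of_tendsto' hlim fun j => (measureReal_mono ?_ ?_).trans (hiter j))
    measureReal_nonneg
  · refine inter_subset_inter_right _ (ball_subset_ball ?_)
    have : (0 : ℝ) < (1 / 2) ^ j := by positivity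
    nlinarith
  · exact ((measure_mono inter_subset_right).trans_lt MeasureTheory.measure_ball_lt_top).ne

/-- At a point of the reduced boundary, `E` has positive lower density. -/
lemma exists_le_volume (h : IsGaussGreen E m σ) {p ν : V} (hp : IsReducedPoint m σ p ν) :
    ∃ c > 0, ∀ᶠ ρ in 𝓝[>] (0 : ℝ), c * ρ ^ finrank ℝ V ≤ volume.real (E ∩ ball p ρ) := by
  refine ⟨volume.real (ball (0 : V) 1) / 2 * (1 / (1024 * 4 ^ finrank ℝ V)) ^ finrank ℝ V,
    mul_pos (half_pos real_volume_unit_ball_pos) (by positivity), ?_⟩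
  filter_upwards [self_mem_nhdsWithin, hp.eventually_forall_tilt (half_pos one_pos),
    eventually_nhdsGT_zero_mul hp.eventually_pos (c := 1 / 4) (by norm_num)]
    with ρ hρ htilt hpos
  rw [mem_Ioi] at hρ
  by_contra! hlt
  -- otherwise `E` has no volume in `B_{ρ/2}`, hence no perimeter in `B_{ρ/4}`
  have h1 := h.volume_half_ball_eq_zero hp.norm_eq_one hρ htilt hlt.le
  have h2 := h.perimeter_le_volume hp.norm_eq_one (p := p) (s := 1 / 4 * ρ) (t := ρ / 2)
    (by positivity) (by linarith) (fun r hr => htilt r (by linarith))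
  rw [h1, mul_zero] at h2
  have : 0 < (ρ / 2 - 1 / 4 * ρ) ^ 2 := pow_pos (by linarith) 2
  nlinarith

/-- The perimeter in `B_R` is at most of order `R ^ (n - 1)`. -/
lemma mul_perimeter_le (h : IsGaussGreen E m σ) {p ν : V} (hν : ‖ν‖ = 1) {R : ℝ} (hR : 0 < R)
    (htilt : ∀ r ≤ 2 * R, TiltLE m σ ν (1 / 2) (ball p r)) :
    R * m.real (ball p R) ≤ 16 * (volume.real (ball (0 : V) 1) * (2 * R) ^ finrank ℝ V) := by
  have h1 := h.perimeter_le_volume hν hR (by linarith : R < 2 * R) htilt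
  have h2 : volume.real (E ∩ ball p (2 * R))
      ≤ volume.real (ball (0 : V) 1) * (2 * R) ^ finrank ℝ V := by
    rw [mul_comm (volume.real _), ← real_volume_ball p (by positivity : 0 < 2 * R)]
    exact measureReal_mono inter_subset_right MeasureTheory.measure_ball_lt_top.ne
  have h3 : R * (R * m.real (ball p R))
      ≤ R * (16 * (volume.real (ball (0 : V) 1) * (2 * R) ^ finrank ℝ V)) := by
    calc R * (R * m.real (ball p R)) = (2 * R - R) ^ 2 * m.real (ball p R) := by ring
      _ ≤ 8 * (2 * R) * volume.real (E ∩ ball p (2 * R)) := h1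
      _ ≤ 8 * (2 * R) * (volume.real (ball (0 : V) 1) * (2 * R) ^ finrank ℝ V) := by gcongr
      _ = _ := by ring
  exact le_of_mul_le_mul_left h3 hR

/-- Little of the perimeter has an inner normal pointing against a vector `a` with `a · ν ≥ 0`. -/
lemma integral_neg_inner_le (h : IsGaussGreen E m σ) {p ν a : V} (hν : ‖ν‖ = 1) {r δ : ℝ}
    (hδ : 0 < δ) (htilt : TiltLE m σ ν (2 * δ ^ 2) (ball p r)) (ha : 0 ≤ inner ℝ a ν) :
    ∫ x in ball p r, max (-inner ℝ a (σ x)) 0 ∂m ≤ 2 * δ * ‖a‖ * m.real (ball p r) := by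
  have hi := (h.integrableOn_tilt ν p r).const_mul (‖a‖ / (2 * δ))
  have hone : IntegrableOn (fun _ => ‖a‖ * δ) (ball p r) m :=
    integrableOn_const (h.measure_ball_lt_top p r).ne
  calc ∫ x in ball p r, max (-inner ℝ a (σ x)) 0 ∂m
      ≤ ∫ x in ball p r, (‖a‖ * δ + ‖a‖ / (2 * δ) * (1 - inner ℝ ν (σ x))) ∂m := by
        refine integral_mono_ae (h.integrableOn_inner a p r).neg.pos_part
          (hone.add hi) (ae_restrict_of_ae ?_)
        filter_upwards [h.norm_eq_one, h.tilt_nonneg hν] with x hx hx'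
        have h1 : -inner ℝ a (σ x) ≤ ‖a‖ * ‖ν - σ x‖ := by
          refine le_trans ?_ (real_inner_le_norm a (ν - σ x))
          rw [inner_sub_right]
          linarith
        have h2 : ‖ν - σ x‖ ^ 2 = 2 * (1 - inner ℝ ν (σ x)) := by
          rw [norm_sub_sq_real, hν, hx]
          ring
        -- Young's inequality, with `|ν - σ|² = 2 (1 - ν · σ)`
        have h3 : ‖ν - σ x‖ ≤ δ + 1 / (2 * δ) * (1 - inner ℝ ν (σ x)) := by
          have : 1 - inner ℝ ν (σ x) = ‖ν - σ x‖ ^ 2 / 2 := by linarith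
          rw [this]
          have h4 : δ + 1 / (2 * δ) * (‖ν - σ x‖ ^ 2 / 2) - ‖ν - σ x‖
              = (‖ν - σ x‖ - 2 * δ) ^ 2 / (4 * δ) := by
            field_simp
            ring
          have : 0 ≤ (‖ν - σ x‖ - 2 * δ) ^ 2 / (4 * δ) := by positivity
          linarith
        have h4 : ‖a‖ * ‖ν - σ x‖ ≤ ‖a‖ * δ + ‖a‖ / (2 * δ) * (1 - inner ℝ ν (σ x)) := by
          calc ‖a‖ * ‖ν - σ x‖ ≤ ‖a‖ * (δ + 1 / (2 * δ) * (1 - inner ℝ ν (σ x))) := by gcongr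
            _ = _ := by ring
        exact max_le (h1.trans h4) (by positivity)
    _ = ‖a‖ * δ * m.real (ball p r)
          + ‖a‖ / (2 * δ) * ∫ x in ball p r, (1 - inner ℝ ν (σ x)) ∂m := by
        rw [integral_add hone hi, integral_const_mul (‖a‖ / (2 * δ)), setIntegral_const, smul_eq_mul]
        ring
    _ ≤ ‖a‖ * δ * m.real (ball p r)
          + ‖a‖ / (2 * δ) * (2 * δ ^ 2 * m.real (ball p r)) := by
        gcongr
        exact htilt
    _ = _ := by
        field_simp
        ring

/-! ### Blow-up at the reduced boundary -/

/-- Under blow-up at `p` the set `E` leaves the half-space `{w | w · ν < 0}`: a point of `E` deep in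
that half-space could be translated onto the points outside `E` near `p` by vectors `a` with
`a · ν ≥ 0`, most of which keep it inside `E`. -/
lemma eventually_volume_inter_ball_le (h : IsGaussGreen E m σ) {p ν w : V}
    (hp : IsReducedPoint m σ p ν) (hw : inner ℝ w ν ≤ -2) {ε : ℝ} (hε : 0 < ε) :
    ∀ᶠ ρ in 𝓝[>] (0 : ℝ), volume.real (E ∩ ball (p + ρ • w) ρ) ≤ ε * ρ ^ finrank ℝ V := by
  obtain ⟨c, hc, hlow⟩ := h.compl.exists_le_volume hp.neg
  set n := finrank ℝ V with hn
  set ω := volume.real (ball (0 : V) 1) with hω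
  have hωpos : 0 < ω := real_volume_unit_ball_pos
  -- `B(p + ρ w, ρ)` lies in `B(p, K ρ)`, and all translations used are shorter than `(K + 1) ρ`
  set K := 1 + ‖w‖ with hK
  have hKpos : 0 < K := by positivity
  set C := 32 * ω ^ 2 * (2 * (2 * K + 1)) ^ n * (K + 1) ^ n / c with hC
  have hCpos : 0 < C := by positivity
  set δ := ε / C with hδ
  have hδpos : 0 < δ := by positivity
  filter_upwards [self_mem_nhdsWithin, hlow,
    eventually_nhdsGT_zero_mul (hp.eventually_forall_tilt (half_pos one_pos))
      (c := 2 * (2 * K + 1)) (by positivity),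
    eventually_nhdsGT_zero_mul (hp.eventually_forall_tilt (ε := 2 * δ ^ 2) (by positivity))
      (c := 2 * K + 1) (by positivity)] with ρ hρ hlow htilt1 htilt2
  rw [mem_Ioi] at hρ
  set R := (2 * K + 1) * ρ with hR
  have hRpos : 0 < R := by positivity
  have hup := h.mul_perimeter_le hp.norm_eq_one (p := p) hRpos
    (fun r hr => htilt1 r (hr.trans_eq (by rw [hR]; ring)))
  have hD : volume.real (ball (0 : V) ((K + 1) * ρ)) = ((K + 1) * ρ) ^ n * ω :=
    real_volume_ball 0 (by positivity)
  have hAball : ∀ x ∈ ball (p + ρ • w) ρ, ‖x - p‖ < K * ρ := by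
    intro x hx
    rw [mem_ball, dist_eq_norm] at hx
    calc ‖x - p‖ = ‖(x - (p + ρ • w)) + ρ • w‖ := by congr 1; abel
      _ ≤ ‖x - (p + ρ • w)‖ + ‖ρ • w‖ := norm_add_le _ _
      _ < ρ + ρ * ‖w‖ := by
        rw [norm_smul, Real.norm_eq_abs, abs_of_pos hρ]
        linarith
      _ = K * ρ := by rw [hK]; ring
  have key := mul_volume_le_of_translate_le (A := E ∩ ball (p + ρ • w) ρ) (C := Eᶜ ∩ ball p ρ)
    (D := ball (0 : V) ((K + 1) * ρ)) (c := c * ρ ^ n) (K := 2 * δ * (16 * (ω * (2 * R) ^ n)))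
    (h.measurableSet.inter measurableSet_ball) (h.measurableSet.compl.inter measurableSet_ball)
    measurableSet_ball
    ((measure_mono inter_subset_right).trans_lt MeasureTheory.measure_ball_lt_top).ne
    MeasureTheory.measure_ball_lt_top.ne (by positivity) ?_ ?_
  · rw [hD] at key
    have hpos : 0 < c * ρ ^ n := by positivity
    refine le_of_mul_le_mul_left (key.trans_eq ?_) hpos
    have : ε = δ * C := by rw [hδ]; field_simp
    rw [this, hC, hR, show 2 * ((2 * K + 1) * ρ) = 2 * (2 * K + 1) * ρ by ring,
      mul_pow (2 * (2 * K + 1)), mul_pow (K + 1)]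
    field_simp
    ring
  · intro x hx
    refine hlow.trans ?_
    have e : volume.real ((fun a => x + a) ⁻¹' (Eᶜ ∩ ball p ρ)) = volume.real (Eᶜ ∩ ball p ρ) := by
      rw [measureReal_def, measure_preimage_add, measureReal_def]
    rw [← e]
    refine measureReal_mono (fun a ha => ⟨?_, ha⟩)
      ((measure_mono fun a ha => ha.1).trans_lt
        (MeasureTheory.measure_ball_lt_top (x := (0 : V)) (r := (K + 1) * ρ))).ne
    have h1 := hAball x hx.2
    have h2 := ha.2
    rw [mem_ball, dist_eq_norm] at h2
    rw [mem_ball, dist_zero_right]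
    calc ‖a‖ = ‖(x + a - p) - (x - p)‖ := by congr 1; abel
      _ ≤ ‖x + a - p‖ + ‖x - p‖ := norm_sub_le _ _
      _ < (K + 1) * ρ := by linarith
  · intro a ha
    rw [mem_ball, dist_zero_right] at ha
    rcases eq_empty_or_nonempty {x | x ∈ E ∩ ball (p + ρ • w) ρ ∧ x + a ∈ Eᶜ ∩ ball p ρ}
      with he | ⟨x, hx⟩
    · rw [he, measureReal_empty]
      positivity
    · -- `a` differs from `-ρ w` by less than `2 ρ`, and `-ρ w · ν ≥ 2 ρ`
      have haν : 0 ≤ inner ℝ a ν := by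
        have h1 := hx.1.2
        have h2 := hx.2.2
        rw [mem_ball, dist_eq_norm] at h1 h2
        have h3 : -inner ℝ (x + a - p) ν ≤ ‖x + a - p‖ := by
          have := (neg_le_abs _).trans (abs_real_inner_le_norm (x + a - p) ν)
          rwa [hp.norm_eq_one, mul_one] at this
        have h4 : inner ℝ (x - (p + ρ • w)) ν ≤ ‖x - (p + ρ • w)‖ := by
          have := real_inner_le_norm (x - (p + ρ • w)) ν
          rwa [hp.norm_eq_one, mul_one] at this
        have h5 : a = (x + a - p) - (x - (p + ρ • w)) - ρ • w := by abel
        rw [h5, inner_sub_left, inner_sub_left, real_inner_smul_left]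
        nlinarith
      have hrad : K * ρ + ‖a‖ ≤ R := by rw [hR]; linarith
      calc volume.real {x | x ∈ E ∩ ball (p + ρ • w) ρ ∧ x + a ∈ Eᶜ ∩ ball p ρ}
          ≤ volume.real {x | x ∈ E ∩ ball p (K * ρ) ∧ x + a ∉ E} := by
            refine measureReal_mono (fun x hx => ⟨⟨hx.1.1, ?_⟩, hx.2.1⟩)
              ((measure_mono fun a ha => ha.1.2).trans_lt
                (MeasureTheory.measure_ball_lt_top (x := p) (r := K * ρ))).ne
            rw [mem_ball, dist_eq_norm]
            exact hAball x hx.1.2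
        _ ≤ 2 * δ * ‖a‖ * m.real (ball p (K * ρ + ‖a‖)) :=
            (h.volume_translate_le p a _).trans
              (h.integral_neg_inner_le hp.norm_eq_one hδpos (htilt2 _ hrad) haν)
        _ ≤ 2 * δ * R * m.real (ball p R) := by
            have : ‖a‖ ≤ R := le_trans (by nlinarith) hrad
            exact mul_le_mul (by gcongr) (h.measureReal_ball_mono p hrad) measureReal_nonneg
              (by positivity)
        _ = 2 * δ * (R * m.real (ball p R)) := by ring
        _ ≤ _ := by gcongr

end IsGaussGreen

/-- The blow-up estimates hold for a set of locally finite perimeter that is only Lebesgue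
measurable, and for its complement. -/
lemma IsDerivOfIndicator.eventually_volume_le {E : Set V} {m : Measure V} {σ : V → V}
    (h : IsDerivOfIndicator E m σ) (hE : NullMeasurableSet E volume) {p ν : V}
    (hp : IsReducedPoint m σ p ν) {ε : ℝ} (hε : 0 < ε) :
    (∀ w, inner ℝ w ν ≤ -2 → ∀ᶠ ρ in 𝓝[>] (0 : ℝ),
      volume.real (E ∩ ball (p + ρ • w) ρ) ≤ ε * ρ ^ finrank ℝ V) ∧
    (∀ w, 2 ≤ inner ℝ w ν → ∀ᶠ ρ in 𝓝[>] (0 : ℝ),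
      volume.real (Eᶜ ∩ ball (p + ρ • w) ρ) ≤ ε * ρ ^ finrank ℝ V) := by
  obtain ⟨E₀, -, hE₀, heq⟩ := hE.exists_measurable_superset_ae_eq
  have hg := h.isGaussGreen hE₀ heq
  refine ⟨fun w hw => ?_, fun w hw => ?_⟩
  · filter_upwards [hg.eventually_volume_inter_ball_le hp hw hε] with ρ hρ
    have e : (E₀ ∩ ball (p + ρ • w) ρ : Set V) =ᵐ[volume] (E ∩ ball (p + ρ • w) ρ : Set V) :=
      heq.inter (ae_eq_refl _)
    rwa [measureReal_congr e] at hρ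
  · have hw' : inner ℝ w (-ν) ≤ -2 := by
      rw [inner_neg_right]
      linarith
    filter_upwards [hg.compl.eventually_volume_inter_ball_le hp.neg hw' hε] with ρ hρ
    have e : (E₀ᶜ ∩ ball (p + ρ • w) ρ : Set V) =ᵐ[volume] (Eᶜ ∩ ball (p + ρ • w) ρ : Set V) :=
      heq.compl.inter (ae_eq_refl _)
    rwa [measureReal_congr e] at hρ

/-- If a linear isometry `L` maps `E` into `E'` near `p`, then it maps the normal of `E` at `p` to
the normal of `E'` at `L p`: otherwise some ball in the blow-up lies inside the image of the
half-space of `E` and outside the half-space of `E'`. -/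
theorem normal_eq_of_image_subset {E E' : Set V} {m m' : Measure V} {σ σ' : V → V}
    (h : IsDerivOfIndicator E m σ) (h' : IsDerivOfIndicator E' m' σ')
    (hE : NullMeasurableSet E volume) (hE' : NullMeasurableSet E' volume) (L : V ≃ₗᵢ[ℝ] V)
    {p ν ν' : V} (hp : IsReducedPoint m σ p ν) (hp' : IsReducedPoint m' σ' (L p) ν')
    (hL : ∀ᶠ y in 𝓝 p, y ∈ E → L y ∈ E') : L ν = ν' := by
  by_contra hne
  have hν : ‖L ν‖ = 1 := by rw [L.norm_map, hp.norm_eq_one]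
  have hν' := hp'.norm_eq_one
  have hpos : 0 < ‖L ν - ν'‖ ^ 2 := by
    have : 0 < ‖L ν - ν'‖ := norm_pos_iff.2 (sub_ne_zero.2 hne)
    positivity
  have hsq : ‖L ν - ν'‖ ^ 2 = 2 * (1 - inner ℝ (L ν) ν') := by
    rw [norm_sub_sq_real, hν, hν']
    ring
  -- a direction into the half-space of `E'ᶜ` whose preimage under `L` points into that of `E`
  set w : V := (4 / ‖L ν - ν'‖ ^ 2) • (L ν - ν') with hw
  have hw1 : inner ℝ (L.symm w) ν = 2 := by
    rw [← L.inner_map_map, L.apply_symm_apply, hw, real_inner_smul_left, inner_sub_left,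
      real_inner_self_eq_norm_sq, hν, real_inner_comm, hsq]
    rw [hsq] at hpos
    have : 1 - inner ℝ (L ν) ν' ≠ 0 := by
      intro h0
      rw [h0] at hpos
      simp at hpos
    field_simp
    ring
  have hw2 : inner ℝ w ν' = -2 := by
    rw [hw, real_inner_smul_left, inner_sub_left, real_inner_self_eq_norm_sq, hν', hsq]
    rw [hsq] at hpos
    have : 1 - inner ℝ (L ν) ν' ≠ 0 := by
      intro h0
      rw [h0] at hpos
      simp at hpos
    field_simp
    ring
  have hω : 0 < volume.real (ball (0 : V) 1) := real_volume_unit_ball_pos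
  obtain ⟨d, hd, hdL⟩ := Metric.eventually_nhds_iff_ball.1 hL
  have hsmall : ∀ᶠ ρ in 𝓝[>] (0 : ℝ), ρ < d / (‖L.symm w‖ + 1) :=
    (eventually_lt_nhds (by positivity)).filter_mono nhdsWithin_le_nhds
  obtain ⟨ρ, hρ, h1, h2, hρd⟩ := (eventually_mem_nhdsWithin.and
    (((h.eventually_volume_le hE hp (ε := volume.real (ball (0 : V) 1) / 3) (by positivity)).2
      (L.symm w) hw1.ge).and
    (((h'.eventually_volume_le hE' hp' (ε := volume.real (ball (0 : V) 1) / 3) (by positivity)).1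
      w hw2.le).and hsmall))).exists
  rw [mem_Ioi] at hρ
  rw [lt_div_iff₀ (by positivity)] at hρd
  have hB := real_volume_ball (p + ρ • L.symm w) hρ
  have hsub : ball (p + ρ • L.symm w) ρ ⊆ ball p d := by
    refine ball_subset_ball' ?_
    rw [dist_eq_norm, add_sub_cancel_left, norm_smul, Real.norm_eq_abs, abs_of_pos hρ]
    linarith
  have himage : volume.real (E ∩ ball (p + ρ • L.symm w) ρ)
      ≤ volume.real (E' ∩ ball (L p + ρ • w) ρ) := by
    have hmp : volume.real (L ⁻¹' (E' ∩ ball (L p + ρ • w) ρ))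
        = volume.real (E' ∩ ball (L p + ρ • w) ρ) := by
      rw [measureReal_def, L.measurePreserving.measure_preimage
        (hE'.inter measurableSet_ball.nullMeasurableSet), measureReal_def]
    rw [← hmp]
    refine measureReal_mono (fun y hy => ⟨hdL y (hsub hy.2) hy.1, ?_⟩) ?_
    · have h3 := hy.2
      rw [mem_ball] at h3 ⊢
      rw [← L.dist_map] at h3
      simpa using h3
    · rw [L.measurePreserving.measure_preimage (hE'.inter measurableSet_ball.nullMeasurableSet)]
      exact ((measure_mono inter_subset_right).trans_lt MeasureTheory.measure_ball_lt_top).ne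
  have hsplit : volume.real (ball (p + ρ • L.symm w) ρ)
      ≤ volume.real (E ∩ ball (p + ρ • L.symm w) ρ)
        + volume.real (Eᶜ ∩ ball (p + ρ • L.symm w) ρ) := by
    refine (measureReal_mono (fun y hy => ?_) ?_).trans (measureReal_union_le _ _)
    · by_cases hyE : y ∈ E
      · exact Or.inl ⟨hyE, hy⟩
      · exact Or.inr ⟨hyE, hy⟩
    · rw [← union_inter_distrib_right]
      exact ((measure_mono inter_subset_right).trans_lt MeasureTheory.measure_ball_lt_top).ne
  have hvol : 0 < ρ ^ finrank ℝ V * volume.real (ball (0 : V) 1) := by positivity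
  linarith

/-! ### The reduced boundary -/

lemma innerNormal_eq {E : Set V} {p ν : V} (h : Tendsto (normalRatio E p) (𝓝[>] 0) (𝓝 ν)) :
    innerNormal E p = ν :=
  h.limUnder_eq

/-- If the reduced boundary is not empty, then the distributional derivative of the characteristic
function is a measure: otherwise `normalRatio` vanishes identically. -/
lemma isDerivOfIndicator_of_mem_reducedBoundary {E : Set V} {p : V}
    (hp : p ∈ reducedBoundary E) :
    IsDerivOfIndicator E (perimeterMeasure E) (indicatorDeriv E).2 := by
  by_cases hex : ∃ d : Measure V × (V → V), IsDerivOfIndicator E d.1 d.2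
  · have := hex.choose_spec
    rwa [perimeterMeasure, indicatorDeriv, dif_pos hex]
  · obtain ⟨ν, hν, hlim⟩ := hp
    have h0 : normalRatio E p = fun _ => 0 := by
      funext ρ
      simp [normalRatio, perimeterMeasure, indicatorDeriv, dif_neg hex]
    rw [h0] at hlim
    rw [← tendsto_nhds_unique tendsto_const_nhds hlim] at hν
    simp at hν

/-- The mean of `ν · σ` over `B_r(p)` is the component along `ν` of `normalRatio`, which tends to
`ν · ν = 1`. -/
lemma isReducedPoint_of_mem_reducedBoundary {E : Set V} {p : V} (hp : p ∈ reducedBoundary E) :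
    IsReducedPoint (perimeterMeasure E) (indicatorDeriv E).2 p (innerNormal E p) := by
  have hder := isDerivOfIndicator_of_mem_reducedBoundary hp
  obtain ⟨ν, hν, hlim⟩ := hp
  rw [innerNormal_eq hlim]
  set m := perimeterMeasure E with hm
  set σ := (indicatorDeriv E).2 with hσ
  have := hder.locallyFinite
  have hpos : ∀ᶠ r in 𝓝[>] (0 : ℝ), 0 < m.real (ball p r) := by
    have hne : ∀ᶠ r in 𝓝[>] (0 : ℝ), normalRatio E p r ≠ 0 :=
      hlim.eventually_ne (by rintro rfl; simp at hν)
    filter_upwards [hne] with r hr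
    refine measureReal_nonneg.lt_of_ne' fun h0 => hr ?_
    rw [normalRatio, ← hm, ← measureReal_def, h0, inv_zero, zero_smul]
  refine ⟨hν, hpos, fun ε hε => ?_⟩
  have hin : Tendsto (fun r => inner ℝ ν (normalRatio E p r)) (𝓝[>] 0) (𝓝 1) := by
    have := (tendsto_const_nhds (x := ν)).inner hlim (𝕜 := ℝ)
    rwa [real_inner_self_eq_norm_sq, hν, one_pow] at this
  filter_upwards [hpos, hin.eventually (lt_mem_nhds (show 1 - ε < 1 by linarith))] with r hr hlt
  have hσi : IntegrableOn σ (ball p r) m :=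
    Measure.integrableOn_of_bounded (M := 1) MeasureTheory.measure_ball_lt_top.ne
      hder.measurable.aestronglyMeasurable
      (ae_restrict_of_ae (hder.norm_eq_one.mono fun _ h => h.le))
  rw [normalRatio, ← hm, ← measureReal_def, real_inner_smul_right, gradMeasure, ← hm, ← hσ,
    ← integral_inner hσi, inv_mul_eq_div, lt_div_iff₀ hr] at hlt
  have hone : IntegrableOn (fun _ => (1 : ℝ)) (ball p r) m :=
    integrableOn_const MeasureTheory.measure_ball_lt_top.ne
  rw [TiltLE, integral_sub hone (hσi.const_inner ν), setIntegral_const, smul_eq_mul, mul_one]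
  linarith

end Blowup

/-! ### Rotations and circularly symmetric sets -/

lemma norm_rot (γ : ℝ) (x : EuclideanSpace ℝ (Fin 2)) : ‖rot γ x‖ = ‖x‖ := by
  rw [EuclideanSpace.norm_eq, EuclideanSpace.norm_eq]
  congr 1
  simp only [rot, Real.norm_eq_abs, sq_abs, Fin.sum_univ_two, PiLp.toLp_apply,
    Matrix.cons_val_zero, Matrix.cons_val_one]
  linear_combination (x 0 ^ 2 + x 1 ^ 2) * Real.sin_sq_add_cos_sq γ

lemma rot_neg_rot (γ : ℝ) (x : EuclideanSpace ℝ (Fin 2)) : rot (-γ) (rot γ x) = x := by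
  ext i
  fin_cases i
  · simp [rot]
    linear_combination x 0 * Real.sin_sq_add_cos_sq γ
  · simp [rot]
    linear_combination x 1 * Real.sin_sq_add_cos_sq γ

/-- The rotation `(x, z) ↦ (R_γ x, z)` as a linear isometry. -/
noncomputable def rotIsometry (k : ℕ) (γ : ℝ) : Space k ≃ₗᵢ[ℝ] Space k where
  toFun p := pt (rot γ p.fst) p.snd
  invFun p := pt (rot (-γ) p.fst) p.snd
  map_add' p q := by
    apply (WithLp.equiv 2 _).injective
    refine Prod.ext ?_ rfl
    ext i
    fin_cases i <;> simp [pt, rot] <;> ring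
  map_smul' c p := by
    apply (WithLp.equiv 2 _).injective
    refine Prod.ext ?_ rfl
    ext i
    fin_cases i <;> simp [pt, rot] <;> ring
  left_inv p := by
    apply (WithLp.equiv 2 _).injective
    exact Prod.ext (rot_neg_rot γ p.fst) rfl
  right_inv p := by
    apply (WithLp.equiv 2 _).injective
    refine Prod.ext ?_ rfl
    have := rot_neg_rot (-γ) p.fst
    rwa [neg_neg] at this
  norm_map' p := by
    change ‖pt (rot γ p.fst) p.snd‖ = ‖p‖
    rw [WithLp.prod_norm_eq_of_L2, WithLp.prod_norm_eq_of_L2]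
    change √(‖rot γ p.fst‖ ^ 2 + ‖p.snd‖ ^ 2) = _
    rw [norm_rot]

/-- A rotation that does not decrease the first coordinate of `x` does not increase the angle
between `x` and `e₁`, hence keeps `(x, z)` in the circularly symmetric set. -/
lemma rotIsometry_mem_circularSymmetral {k : ℕ} {μ : ℝ × EuclideanSpace ℝ (Fin (k - 2)) → ℝ}
    {γ : ℝ} {p : Space k} (hp : p ∈ circularSymmetral μ) (h : p.fst 0 ≤ rot γ p.fst 0) :
    rotIsometry k γ p ∈ circularSymmetral μ := by
  obtain ⟨h0, hlt⟩ := hp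
  change rot γ p.fst ≠ 0 ∧ 2 * ‖rot γ p.fst‖ * Real.arccos
    (inner ℝ (‖rot γ p.fst‖⁻¹ • rot γ p.fst) (EuclideanSpace.single 0 1))
      < μ (‖rot γ p.fst‖, p.snd)
  rw [norm_rot]
  refine ⟨fun h => h0 ?_, lt_of_le_of_lt ?_ hlt⟩
  · rw [← norm_eq_zero, ← norm_rot γ, h, norm_zero]
  · refine mul_le_mul_of_nonneg_left (Real.arccos_le_arccos ?_) (by positivity)
    rw [real_inner_smul_left, real_inner_smul_left]
    refine mul_le_mul_of_nonneg_left ?_ (by positivity)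
    simpa [EuclideanSpace.inner_single_right] using h

/-- Rotating a point at angle `β` towards the positive first axis, without crossing to the other
side of the axis, strictly increases its first coordinate. -/
lemma cos_lt_cos_add {β γ : ℝ} (hβ : β ∈ Ioc (-Real.pi) Real.pi)
    (hγ : γ ∈ Icc (min (-β) 0) (max (-β) 0)) (hγ0 : γ ≠ 0) :
    Real.cos β < Real.cos (β + γ) := by
  rw [← Real.cos_abs β, ← Real.cos_abs (β + γ)]
  refine Real.cos_lt_cos_of_nonneg_of_le_pi (abs_nonneg _) (abs_le.2 ⟨hβ.1.le, hβ.2⟩) ?_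
  rcases le_total β 0 with hb | hb
  · rw [min_eq_right (by linarith), max_eq_left (by linarith)] at hγ
    have : 0 < γ := hγ.1.lt_of_ne' hγ0
    rw [abs_of_nonpos hb, abs_of_nonpos (by linarith [hγ.2])]
    linarith
  · rw [min_eq_left (by linarith), max_eq_right (by linarith)] at hγ
    have : γ < 0 := hγ.2.lt_of_ne hγ0
    rw [abs_of_nonneg hb, abs_of_nonneg (by linarith [hγ.1])]
    linarith

lemma rot_zero (x : EuclideanSpace ℝ (Fin 2)) : rot 0 x = x := by
  ext i
  fin_cases i <;> simp [rot]

theorem mainTheorem7 (k : ℕ) (hk : 2 ≤ k)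
    (μ : ℝ × EuclideanSpace ℝ (Fin (k - 2)) → ℝ)
    (hμ_meas : NullMeasurable μ (volume.restrict (halfSpace k)))
    (hμ_nonneg : ∀ q ∈ halfSpace k, 0 ≤ μ q)
    (hμ_le : ∀ᵐ q ∂(volume.restrict (halfSpace k)), μ q ≤ 2 * Real.pi * q.1)
    (hF : HasLocallyFinitePerimeter (circularSymmetral μ))
    (x : EuclideanSpace ℝ (Fin 2)) (z : EuclideanSpace ℝ (Fin (k - 2)))
    (hxz : pt x z ∈ reducedBoundary (circularSymmetral μ))
    (r β : ℝ) (hr : 0 < r) (hβ : β ∈ Ioc (-Real.pi) Real.pi)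
    (hx : x = r • !₂[Real.cos β, Real.sin β])
    (γ : ℝ) (hγ : γ ∈ Icc (min (-β) 0) (max (-β) 0))
    (hγx : rot γ x ∈ circularSlice (reducedBoundary (circularSymmetral μ)) r z) :
    innerNormal (circularSymmetral μ) (pt (rot γ x) z) =
      pt (rot γ (innerNormal (circularSymmetral μ) (pt x z)).fst)
        (innerNormal (circularSymmetral μ) (pt x z)).snd := by
  rcases eq_or_ne γ 0 with rfl | hγ0
  · rw [rot_zero, rot_zero]
    rfl
  have hγz : rotIsometry k γ (pt x z) ∈ reducedBoundary (circularSymmetral μ) := hγx.2.2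
  have hder := isDerivOfIndicator_of_mem_reducedBoundary hxz
  refine (normal_eq_of_image_subset hder hder hF.1 hF.1 (rotIsometry k γ)
    (isReducedPoint_of_mem_reducedBoundary hxz)
    (isReducedPoint_of_mem_reducedBoundary hγz) ?_).symm
  have hopen : ∀ᶠ p : Space k in 𝓝 (pt x z),
      p.fst 0 < Real.cos γ * p.fst 0 - Real.sin γ * p.fst 1 := by
    refine (ContinuousAt.eventually_lt (f := fun p : Space k => p.fst 0)
      (g := fun p : Space k => Real.cos γ * p.fst 0 - Real.sin γ * p.fst 1)
      (by fun_prop) (by fun_prop) ?_)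
    have h1 := mul_lt_mul_of_pos_left (cos_lt_cos_add hβ hγ hγ0) hr
    rw [Real.cos_add] at h1
    have e0 : (pt x z : Space k).fst 0 = r * Real.cos β := by simp [pt, hx]
    have e1 : (pt x z : Space k).fst 1 = r * Real.sin β := by simp [pt, hx]
    rw [e0, e1]
    linarith
  filter_upwards [hopen] with p hlt hp
  exact rotIsometry_mem_circularSymmetral hp (by simpa [rot] using hlt.le)
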